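/- Let $(\Omega,\mathcal F,\mathbb P)$ be a probability space and let $\mathbf L=(L_1,\ldots,L_k)^{\top}=\{\mathbf L(t)\}_{t\in\mathbb R}$ be a two-sided $k$-dimensional Lévy process, i.e. $\mathbf L(0)=0$ a.s., $\mathbf L$ has independent and stationary increments over $\mathbb R$, and $\mathbf L$ is stochastically continuous. Assume that $\mathbf L$ is square-integrable with zero mean. Let $G=(g_{ij})$ be a measurable map from $\mathbb R_+=[0,\infty)$ to the real $m\times k$ matrices with $g_{ij}\in L^2(\mathbb R_+)$ for $i=1,\ldots,m$, $j=1,\ldots,k$. For $f\in L^2(\mathbb R)$ the stochastic integral $\int_{\mathbb R}f(s)\,dL_j(s)$ is the $L^2(\mathbb P)$-limit of the elementary integrals $\sum_l c_l\,(L_j(b_l)-L_j(a_l))$ of step functions $\sum_l c_l\mathbf 1_{(a_l,b_l]}$ that converge to $f$ in $L^2(\mathbb R)$. Then the Lévy stationary process $$\mathbf X^m(t)=\int_{-\infty}^tG(t-s)\,d\mathbf L(s),\qquad X_i(t)=\sum_{j=1}^k\int_{\mathbb R}\mathbf 1_{\{s\le t\}}\,g_{ij}(t-s)\,dL_j(s),\qquad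 t\in\mathbb R,$$ exists, and (every version of) it is strictly stationary: for every $\tau\ge 0$, every $r\in\mathbb N$ and all $t_1,\ldots,t_r\in\mathbb R$, the $m\times r$-dimensional random matrices $(\mathbf X^m(t_1+\tau),\ldots,\mathbf X^m(t_r+\tau))$ and $(\mathbf X^m(t_1),\ldots,\mathbf X^m(t_r))$ have the same probability distribution. -/

import Mathlib

open MeasureTheory ProbabilityTheory Filter Topology

namespace LevyStationary

noncomputable section

/-- A two-sided `k`-dimensional Lévy process on the probability space `(Ω, P)`: it starts at `0`,
has independent and stationary increments over the whole real line, and is stochastically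
continuous. (Càdlàg paths are not required; a càdlàg process with stationary increments is
stochastically continuous.) -/
structure IsTwoSidedLevyProcess {Ω : Type*} [MeasurableSpace Ω] (P : Measure Ω) {k : ℕ}
    (L : ℝ → Ω → EuclideanSpace ℝ (Fin k)) : Prop where
  measurable : ∀ t, Measurable (L t)
  start_zero : ∀ᵐ ω ∂P, L 0 ω = 0
  indep_increments : HasIndepIncrements L P
  stationary_increments : ∀ s t : ℝ, s ≤ t → ∀ h : ℝ,
    IdentDistrib (fun ω => L (t + h) ω - L (s + h) ω) (fun ω => L t ω - L s ω) P P
  stochastically_continuous : ∀ t, TendstoInMeasure P L (𝓝 t) (L t)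

/-- Data of a step function `∑ l, c l • 1_{(a l, b l]}` on the real line. -/
structure StepData where
  n : ℕ
  a : Fin n → ℝ
  b : Fin n → ℝ
  c : Fin n → ℝ
  a_le_b : ∀ l, a l ≤ b l

/-- The step function `s ↦ ∑ l, c l * 1_{(a l, b l]}(s)`. -/
def StepData.toFun (φ : StepData) (s : ℝ) : ℝ :=
  ∑ l, (Set.Ioc (φ.a l) (φ.b l)).indicator (fun _ => φ.c l) s

/-- The elementary integral `∑ l, c l * (Z (b l) - Z (a l))` of a step function against a
real-valued process `Z`. -/
def StepData.integral (φ : StepData) {Ω : Type*} (Z : ℝ → Ω → ℝ) (ω : Ω) : ℝ :=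
  ∑ l, φ.c l * (Z (φ.b l) ω - Z (φ.a l) ω)

/-- `Y` is (a version of) the stochastic integral `∫_ℝ f(s) dZ(s)` of the deterministic function
`f ∈ L²(ℝ)`: the `L²(P)`-limit of the elementary integrals of step functions that converge
to `f` in `L²(ℝ)`. -/
def IsStochIntegral {Ω : Type*} [MeasurableSpace Ω] (P : Measure Ω) (Z : ℝ → Ω → ℝ)
    (f : ℝ → ℝ) (Y : Ω → ℝ) : Prop :=
  MemLp f 2 volume ∧ MemLp Y 2 P ∧
    ∃ φ : ℕ → StepData,
      Tendsto (fun n => eLpNorm (fun s => (φ n).toFun s - f s) 2 volume) atTop (𝓝 0) ∧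
      Tendsto (fun n => eLpNorm (fun ω => (φ n).integral Z ω - Y ω) 2 P) atTop (𝓝 0)

/-- `X` is (a version of) the process `X(t) = ∫_{-∞}^t G(t - s) dL(s)`, `t ∈ ℝ`: for every `t`,
almost surely `X_i(t) = ∑ j, ∫_ℝ 1_{s ≤ t} g_{ij}(t - s) dL_j(s)` for all `i`.
Only the values of `G` on `[0, ∞)` enter. -/
def IsLevyStationaryProcess {Ω : Type*} [MeasurableSpace Ω] (P : Measure Ω) {m k : ℕ}
    (L : ℝ → Ω → EuclideanSpace ℝ (Fin k)) (G : ℝ → Matrix (Fin m) (Fin k) ℝ)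
    (X : ℝ → Ω → EuclideanSpace ℝ (Fin m)) : Prop :=
  ∃ Y : ℝ → Fin m → Fin k → Ω → ℝ,
    (∀ t i j, IsStochIntegral P (fun s ω => L s ω j)
      ((Set.Iic t).indicator fun s => G (t - s) i j) (Y t i j)) ∧
    ∀ t, ∀ᵐ ω ∂P, ∀ i, X t ω i = ∑ j, Y t i j ω

/-- Strict stationarity of a process indexed by `ℝ`: its finite-dimensional distributions are
invariant under time shifts. -/
def IsStrictlyStationary {Ω E : Type*} [MeasurableSpace Ω] [MeasurableSpace E] (P : Measure Ω)
    (X : ℝ → Ω → E) : Prop :=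
  ∀ τ : ℝ, 0 ≤ τ → ∀ (r : ℕ) (t : Fin r → ℝ),
    IdentDistrib (fun ω (l : Fin r) => X (t l + τ) ω) (fun ω (l : Fin r) => X (t l) ω) P P

end

end LevyStationary

namespace LevyStationary

open scoped ENNReal

/-! Independence, stationarity and zero mean make the variance of an increment of `L_j` equal to `v
* |t - s|`. Polarisation turns this into the Itô isometry for elementary integrals
(`eLpNorm_integral_sub_integral`). Since step functions are dense in `L²(ℝ)`, the integrals, and
hence `X`, exist by completeness.

For stationarity, the joint law of finitely many increments is shift invariant
(`identDistrib_increments`), and so is that of finitely many elementary integrals. The kernel at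
time `t + τ` is the kernel at `t` translated by `τ`. By the isometry, translates of step functions
approximating the latter therefore have integrals converging to any version of the former
(`IsStochIntegral.tendsto_shift`). Equality of joint laws survives `L²` limits, and `X` is a.s. a
measurable image of these integrals. Working with joint laws means that dependence between the
components of `L` needs no separate treatment. -/

/-- An additive nonnegative function on `[0, ∞)` is linear. -/
lemma eq_mul_of_additive_nonneg {V : ℝ → ℝ} (h0 : ∀ x, 0 ≤ V x)
    (hadd : ∀ x y, 0 ≤ x → 0 ≤ y → V (x + y) = V x + V y) {x : ℝ} (hx : 0 ≤ x) :
    V x = V 1 * x := by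
  have hV0 : V 0 = 0 := by have := hadd 0 0 le_rfl le_rfl; simp at this; exact this
  have hn : ∀ (n : ℕ) (y : ℝ), 0 ≤ y → V (n * y) = n * V y := by
    intro n y hy
    induction n with
    | zero => simp [hV0]
    | succ n ih =>
      have : ((n + 1 : ℕ) : ℝ) * y = n * y + y := by push_cast; ring
      rw [this, hadd _ _ (by positivity) hy, ih]; push_cast; ring
  have hmono : ∀ y z, 0 ≤ y → y ≤ z → V y ≤ V z := by
    intro y z hy hz
    have := hadd y (z - y) hy (by linarith)
    rw [add_sub_cancel] at this
    linarith [h0 (z - y)]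
  have hcast : ∀ n : ℕ, V n = n * V 1 := fun n => by simpa using hn n 1 zero_le_one
  -- By monotonicity `n * V x` and `n * (V 1 * x)` both lie between `⌊n x⌋ * V 1` and `(⌊n x⌋ + 1) *
  -- V 1`.
  have key : ∀ n : ℕ, n * |V x - V 1 * x| ≤ V 1 := by
    intro n
    have hnx : 0 ≤ (n : ℝ) * x := by positivity
    have h1 := hmono _ _ (Nat.cast_nonneg _) (Nat.floor_le hnx)
    have h2 := hmono _ _ hnx (Nat.lt_floor_add_one ((n : ℝ) * x)).le
    have h3 := hcast (⌊(n : ℝ) * x⌋₊ + 1)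
    push_cast at h3
    rw [hcast, hn n x hx] at h1
    rw [h3, hn n x hx] at h2
    rw [← abs_of_nonneg (Nat.cast_nonneg (α := ℝ) n), ← abs_mul, abs_le]
    have h4 := mul_le_mul_of_nonneg_right (Nat.floor_le hnx) (h0 1)
    have h5 := mul_le_mul_of_nonneg_right (Nat.lt_floor_add_one ((n : ℝ) * x)).le (h0 1)
    constructor <;> nlinarith
  by_contra hne
  have hpos : 0 < |V x - V 1 * x| := abs_pos.2 (sub_ne_zero.2 hne)
  obtain ⟨n, hn'⟩ := exists_nat_gt (V 1 / |V x - V 1 * x|)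
  rw [div_lt_iff₀ hpos] at hn'
  exact absurd (key n) (not_le.2 hn')

lemma eLpNorm_two_eq_ofReal_sqrt {α : Type*} [MeasurableSpace α] {μ : Measure α} {f : α → ℝ}
    (hf : MemLp f 2 μ) : eLpNorm f 2 μ = ENNReal.ofReal (√(∫ x, f x ^ 2 ∂μ)) := by
  rw [hf.eLpNorm_eq_integral_rpow_norm (by simp) (by simp), Real.sqrt_eq_rpow]
  simp

lemma integral_sum_sq {α ι : Type*} [Fintype ι] [MeasurableSpace α] {μ : Measure α}
    {f : ι → α → ℝ} (hf : ∀ i, MemLp (f i) 2 μ) :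
    ∫ x, (∑ i, f i x) ^ 2 ∂μ = ∑ i, ∑ j, ∫ x, f i x * f j x ∂μ := by
  have hi (i j) : Integrable (fun x => f i x * f j x) μ := (hf i).integrable_mul (hf j)
  simp_rw [sq, Finset.sum_mul_sum]
  rw [integral_finsetSum _ fun i _ => integrable_finsetSum _ fun j _ => hi i j]
  exact Finset.sum_congr rfl fun i _ => integral_finsetSum _ fun j _ => hi i j

/-! ### Step functions and the Itô isometry for elementary integrals -/

namespace StepData

/-- The data of the difference of two step functions. -/
def sub (φ ψ : StepData) : StepData where
  n := φ.n + ψ.n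
  a := Fin.append φ.a ψ.a
  b := Fin.append φ.b ψ.b
  c := Fin.append φ.c (fun l => -ψ.c l)
  a_le_b l := by refine Fin.addCases ?_ ?_ l <;> intro i <;> simp [φ.a_le_b, ψ.a_le_b]

lemma toFun_sub (φ ψ : StepData) (s : ℝ) : (φ.sub ψ).toFun s = φ.toFun s - ψ.toFun s := by
  unfold StepData.toFun
  rw [sub_eq_add_neg, ← Finset.sum_neg_distrib]
  refine (Fin.sum_univ_add _).trans ?_
  simp [sub, Set.indicator_apply, apply_ite]

lemma integral_sub (φ ψ : StepData) {Ω : Type*} (Z : ℝ → Ω → ℝ) (ω : Ω) :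
    (φ.sub ψ).integral Z ω = φ.integral Z ω - ψ.integral Z ω := by
  unfold StepData.integral
  rw [sub_eq_add_neg, ← Finset.sum_neg_distrib]
  refine (Fin.sum_univ_add _).trans ?_
  simp [sub]

/-- The data of the translate `s ↦ φ (s - τ)` of a step function `φ`. -/
def shift (φ : StepData) (τ : ℝ) : StepData where
  n := φ.n
  a l := φ.a l + τ
  b l := φ.b l + τ
  c := φ.c
  a_le_b l := by simpa using φ.a_le_b l

lemma toFun_shift (φ : StepData) (τ s : ℝ) : (φ.shift τ).toFun s = φ.toFun (s - τ) := by
  simp only [StepData.toFun, shift, Set.indicator_apply, Set.mem_Ioc, lt_sub_iff_add_lt,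
    sub_le_iff_le_add]
  rfl

lemma memLp_toFun (φ : StepData) : MemLp φ.toFun 2 volume :=
  memLp_finsetSum _ fun l _ => memLp_indicator_const 2 measurableSet_Ioc _ (Or.inr (by simp))

lemma memLp_integral (φ : StepData) {Ω : Type*} [MeasurableSpace Ω] {P : Measure Ω}
    {Z : ℝ → Ω → ℝ} (hZ : ∀ t, MemLp (Z t) 2 P) : MemLp (φ.integral Z) 2 P :=
  memLp_finsetSum _ fun l _ => ((hZ (φ.b l)).sub (hZ (φ.a l))).const_mul (φ.c l)

/-- The overlap length is written with absolute values of endpoint differences so that it matches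
the increment covariance term by term, whatever the position of the intervals. -/
lemma integral_indicator_mul_indicator {a b a' b' : ℝ} (h : a ≤ b) (h' : a' ≤ b') (c c' : ℝ) :
    ∫ s, (Set.Ioc a b).indicator (fun _ => c) s * (Set.Ioc a' b').indicator (fun _ => c') s =
      c * c' * ((|b - a'| + |a - b'| - |b - b'| - |a - a'|) / 2) := by
  have : (fun s => (Set.Ioc a b).indicator (fun _ => c) s *
      (Set.Ioc a' b').indicator (fun _ => c') s) =
      (Set.Ioc (max a a') (min b b')).indicator fun _ => c * c' := by
    ext s
    rw [← Set.Ioc_inter_Ioc, ← Set.inter_indicator_mul]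
  rw [this, integral_indicator_const _ measurableSet_Ioc, smul_eq_mul, mul_comm, measureReal_def,
    Real.volume_Ioc, ENNReal.toReal_ofReal']
  congr 1
  grind

lemma integral_toFun_sq (φ : StepData) :
    ∫ s, φ.toFun s ^ 2 = ∑ l, ∑ l', φ.c l * φ.c l' * ((|φ.b l - φ.a l'| + |φ.a l - φ.b l'|
      - |φ.b l - φ.b l'| - |φ.a l - φ.a l'|) / 2) := by
  have hm (l) : MemLp ((Set.Ioc (φ.a l) (φ.b l)).indicator fun _ => φ.c l) 2 volume :=
    memLp_indicator_const 2 measurableSet_Ioc _ (Or.inr (by simp))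
  simp_rw [StepData.toFun]
  rw [integral_sum_sq hm]
  exact Finset.sum_congr rfl fun l _ => Finset.sum_congr rfl fun l' _ =>
    integral_indicator_mul_indicator (φ.a_le_b l) (φ.a_le_b l') _ _

variable {Ω : Type*} [MeasurableSpace Ω] {P : Measure Ω} {Z : ℝ → Ω → ℝ} {v : ℝ}

/-- Polarisation: the product is a combination of four squared increments, so `hv` alone determines
the covariance, even for overlapping intervals. -/
lemma integral_increment_mul_increment (hZ : ∀ t, MemLp (Z t) 2 P)
    (hv : ∀ s t, ∫ ω, (Z t ω - Z s ω) ^ 2 ∂P = v * |t - s|) (a b a' b' : ℝ) :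
    ∫ ω, (Z b ω - Z a ω) * (Z b' ω - Z a' ω) ∂P =
      v * ((|b - a'| + |a - b'| - |b - b'| - |a - a'|) / 2) := by
  have hi (s t) : Integrable (fun ω => (Z t ω - Z s ω) ^ 2) P := ((hZ t).sub (hZ s)).integrable_sq
  have : ∀ ω, (Z b ω - Z a ω) * (Z b' ω - Z a' ω) = ((Z b ω - Z a' ω) ^ 2 + (Z a ω - Z b' ω) ^ 2
      - (Z b ω - Z b' ω) ^ 2 - (Z a ω - Z a' ω) ^ 2) / 2 := fun ω => by ring
  simp_rw [this]
  have h1 : Integrable (fun ω => (Z b ω - Z a' ω) ^ 2 + (Z a ω - Z b' ω) ^ 2) P :=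
    (hi _ _).add (hi _ _)
  have h2 : Integrable (fun ω => (Z b ω - Z a' ω) ^ 2 + (Z a ω - Z b' ω) ^ 2
      - (Z b ω - Z b' ω) ^ 2) P := h1.sub (hi _ _)
  rw [integral_div, MeasureTheory.integral_sub h2 (hi _ _), MeasureTheory.integral_sub h1 (hi _ _),
    integral_add (hi _ _) (hi _ _), hv, hv, hv, hv]
  ring

lemma integral_integral_sq (φ : StepData) (hZ : ∀ t, MemLp (Z t) 2 P)
    (hv : ∀ s t, ∫ ω, (Z t ω - Z s ω) ^ 2 ∂P = v * |t - s|) :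
    ∫ ω, φ.integral Z ω ^ 2 ∂P = v * ∫ s, φ.toFun s ^ 2 := by
  have hm (l) : MemLp (fun ω => φ.c l * (Z (φ.b l) ω - Z (φ.a l) ω)) 2 P :=
    ((hZ (φ.b l)).sub (hZ (φ.a l))).const_mul (φ.c l)
  simp_rw [StepData.integral]
  rw [integral_toFun_sq, integral_sum_sq hm, Finset.mul_sum]
  refine Finset.sum_congr rfl fun l _ => ?_
  rw [Finset.mul_sum]
  refine Finset.sum_congr rfl fun l' _ => ?_
  have := integral_increment_mul_increment hZ hv (φ.a l) (φ.b l) (φ.a l') (φ.b l')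
  have hmul : ∀ ω, φ.c l * (Z (φ.b l) ω - Z (φ.a l) ω) * (φ.c l' * (Z (φ.b l') ω - Z (φ.a l') ω)) =
      φ.c l * φ.c l' * ((Z (φ.b l) ω - Z (φ.a l) ω) * (Z (φ.b l') ω - Z (φ.a l') ω)) :=
    fun ω => mul_mul_mul_comm _ _ _ _
  rw [integral_congr_ae (Eventually.of_forall hmul), integral_const_mul, this]
  ring

/-- The Itô isometry for elementary integrals. -/
lemma eLpNorm_integral_sub_integral (φ ψ : StepData) (hZ : ∀ t, MemLp (Z t) 2 P)
    (hv : ∀ s t, ∫ ω, (Z t ω - Z s ω) ^ 2 ∂P = v * |t - s|) (hv0 : 0 ≤ v) :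
    eLpNorm (fun ω => φ.integral Z ω - ψ.integral Z ω) 2 P =
      ENNReal.ofReal (√v) * eLpNorm (fun s => φ.toFun s - ψ.toFun s) 2 volume := by
  simp_rw [← integral_sub, ← toFun_sub]
  rw [eLpNorm_two_eq_ofReal_sqrt ((φ.sub ψ).memLp_integral hZ),
    eLpNorm_two_eq_ofReal_sqrt (φ.sub ψ).memLp_toFun, integral_integral_sq _ hZ hv,
    Real.sqrt_mul hv0, ENNReal.ofReal_mul (Real.sqrt_nonneg _)]

end StepData

/-! ### Density of step functions -/

lemma exists_stepData_abs_sub_le {g : ℝ → ℝ} (hg : UniformContinuous g) {R : ℝ} (hR : 0 < R)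
    (hsupp : ∀ s, R ≤ |s| → g s = 0) {ε : ℝ} (hε : 0 < ε) :
    ∃ φ : StepData, ∀ s, |φ.toFun s - g s| ≤ (Set.Ioc (-R) R).indicator (fun _ => ε) s := by
  obtain ⟨δ, hδ, hgδ⟩ := Metric.uniformContinuous_iff.1 hg ε hε
  obtain ⟨N, hN⟩ := exists_nat_gt (2 * R / δ)
  have hN0 : (0 : ℝ) < N := lt_of_le_of_lt (by positivity) hN
  set h : ℝ := 2 * R / N with hh
  have hh0 : 0 < h := by positivity
  have hNh : N * h = 2 * R := by rw [hh]; field_simp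
  have hhδ : h < δ := by
    rw [hh, div_lt_iff₀ hN0]; rw [div_lt_iff₀ hδ] at hN; linarith
  -- A uniform grid of mesh `h < δ` on `(-R, R]`, with `g` sampled at right endpoints.
  refine ⟨⟨N, fun l => -R + l * h, fun l => -R + (l + 1) * h, fun l => g (-R + (l + 1) * h),
    fun l => by nlinarith⟩, fun s => ?_⟩
  by_cases hs : s ∈ Set.Ioc (-R) R
  · rw [Set.indicator_of_mem hs]
    have hpos : 0 < (s + R) / h := div_pos (by linarith [hs.1]) hh0
    have hc1 : 0 < ⌈(s + R) / h⌉₊ := Nat.ceil_pos.2 hpos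
    have hc2 : ⌈(s + R) / h⌉₊ ≤ N := by
      rw [Nat.ceil_le, div_le_iff₀ hh0, hNh]; linarith [hs.2]
    -- Cells are open on the left and closed on the right, so the cell containing `s` is found by a
    -- ceiling, less one.
    obtain ⟨p, hp⟩ : ∃ p, ⌈(s + R) / h⌉₊ = p + 1 := ⟨_, (Nat.succ_pred_eq_of_pos hc1).symm⟩
    rw [hp] at hc2
    have hmem : ∀ l : ℕ, s ∈ Set.Ioc (-R + l * h) (-R + (l + 1) * h) ↔ l = p := by
      intro l
      have := Nat.ceil_eq_iff (a := (s + R) / h) (n := l + 1) (by simp)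
      rw [hp, lt_div_iff₀ hh0, div_le_iff₀ hh0] at this
      simp only [Nat.add_sub_cancel, Nat.cast_add, Nat.cast_one] at this
      rw [Set.mem_Ioc]
      constructor
      · intro hl
        have := this.2 ⟨by linarith [hl.1], by linarith [hl.2]⟩
        omega
      · rintro rfl
        have := this.1 rfl
        constructor <;> linarith [this.1, this.2]
    have hsum : StepData.toFun ⟨N, fun l => -R + l * h, fun l => -R + (l + 1) * h,
        fun l => g (-R + (l + 1) * h), fun l => by nlinarith⟩ s = g (-R + (p + 1) * h) := by
      unfold StepData.toFun
      rw [Finset.sum_eq_single ⟨p, hc2⟩]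
      · simp only
        rw [Set.indicator_of_mem ((hmem p).2 rfl)]
      · intro l _ hl
        refine Set.indicator_of_notMem (fun hm => hl (Fin.ext ((hmem l).1 hm))) _
      · simp
    rw [hsum]
    have hp' := (hmem p).2 rfl
    refine (hgδ ?_).le
    rw [Real.dist_eq, abs_lt]
    constructor <;> linarith [hp'.1, hp'.2]
  · rw [Set.indicator_of_notMem hs, hsupp s, sub_zero, abs_nonpos_iff]
    · refine Finset.sum_eq_zero fun l _ => Set.indicator_of_notMem (fun hm => hs ?_) _
      have hl : ((l : ℕ) : ℝ) + 1 ≤ N := by exact_mod_cast l.2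
      have h1 : (0 : ℝ) ≤ (l : ℕ) * h := by positivity
      have h2 := mul_le_mul_of_nonneg_right hl hh0.le
      simp only [Set.mem_Ioc] at hm
      exact ⟨by linarith [hm.1], by linarith [hm.2]⟩
    · by_contra hlt
      rw [not_le, abs_lt] at hlt
      exact hs ⟨hlt.1, hlt.2.le⟩

/-- Step functions are dense in `L²(ℝ)`. -/
lemma exists_stepData_eLpNorm_sub_le {f : ℝ → ℝ} (hf : MemLp f 2 volume) {ε : ℝ≥0∞}
    (hε : ε ≠ 0) : ∃ φ : StepData, eLpNorm (fun s => φ.toFun s - f s) 2 volume ≤ ε := by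
  obtain ⟨g, hgs, hfg, hgc, hgm⟩ :=
    hf.exists_hasCompactSupport_eLpNorm_sub_le (by simp) (ENNReal.half_pos hε).ne'
  obtain ⟨R, hR, hsub⟩ := hgs.isCompact.isBounded.subset_ball_lt 0 0
  have hsupp : ∀ s, R ≤ |s| → g s = 0 := by
    intro s hs
    by_contra hne
    have := hsub (subset_tsupport g hne)
    rw [mem_ball_zero_iff, Real.norm_eq_abs] at this
    linarith
  obtain ⟨η, hη, hηε⟩ : ∃ η : ℝ, 0 < η ∧
      ENNReal.ofReal η * volume (Set.Ioc (-R) R) ^ (1 / (2 : ℝ≥0∞).toReal) ≤ ε / 2 := by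
    have ht : Tendsto (fun η : ℝ => ENNReal.ofReal η *
        volume (Set.Ioc (-R) R) ^ (1 / (2 : ℝ≥0∞).toReal)) (𝓝[>] 0) (𝓝 (ENNReal.ofReal 0 *
        volume (Set.Ioc (-R) R) ^ (1 / (2 : ℝ≥0∞).toReal))) := by
      refine ENNReal.Tendsto.mul_const
        ((ENNReal.continuous_ofReal.tendsto 0).mono_left nhdsWithin_le_nhds) (Or.inr ?_)
      exact ENNReal.rpow_ne_top_of_nonneg (by positivity) (by simp)
    rw [ENNReal.ofReal_zero, zero_mul] at ht
    have := (ht.eventually_le_const (ENNReal.half_pos hε)).and self_mem_nhdsWithin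
    obtain ⟨η, h1, h2⟩ := this.exists
    exact ⟨η, h2, h1⟩
  obtain ⟨φ, hφ⟩ := exists_stepData_abs_sub_le
    (hgs.uniformContinuous_of_continuous hgc) hR hsupp hη
  refine ⟨φ, ?_⟩
  have h1 : eLpNorm (φ.toFun - g) 2 volume ≤ ε / 2 := by
    refine (eLpNorm_mono_real hφ).trans ?_
    rw [eLpNorm_indicator_const measurableSet_Ioc (by simp) (by simp)]
    simpa [Real.enorm_eq_ofReal hη.le] using hηε
  have h2 : (fun s => φ.toFun s - f s) = (φ.toFun - g) - (f - g) := by ext s; simp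
  rw [h2]
  calc _ ≤ _ := eLpNorm_sub_le (φ.memLp_toFun.sub hgm).1 (hf.sub hgm).1 (by norm_num)
    _ ≤ ε / 2 + ε / 2 := add_le_add h1 hfg
    _ = ε := ENNReal.add_halves ε


/-! ### Existence of the integral and passage to the limit in law -/

variable {Ω : Type*} [MeasurableSpace Ω] {P : Measure Ω}

lemma exists_isStochIntegral {Z : ℝ → Ω → ℝ} {v : ℝ} (hZ : ∀ t, MemLp (Z t) 2 P)
    (hv : ∀ s t, ∫ ω, (Z t ω - Z s ω) ^ 2 ∂P = v * |t - s|) (hv0 : 0 ≤ v) {f : ℝ → ℝ}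
    (hf : MemLp f 2 volume) : ∃ Y, IsStochIntegral P Z f Y := by
  set C : ℝ≥0∞ := ENNReal.ofReal (√v) with hC
  set B : ℕ → ℝ≥0∞ := fun n => 2⁻¹ ^ n with hB
  have hB0 (n) : B n ≠ 0 := pow_ne_zero _ (by simp)
  have hBt (n) : B n ≠ ∞ := ENNReal.pow_ne_top (by simp)
  have hC1 : C + 1 ≠ ∞ := by simp [hC]
  have hBanti : Antitone B := fun m n h => pow_le_pow_right_of_le_one' (by simp) h
  -- `C + 1` stays invertible when `v = 0`; two errors with `B n / 4` add up to `B n / 2`, which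
  -- leaves the strict inequality required of a Cauchy sequence with summable bounds.
  choose φ hφ using fun n => exists_stepData_eLpNorm_sub_le hf
    (ε := (C + 1)⁻¹ * (B n / 4)) (by simp [hC1, hB0])
  have hlim : Tendsto (fun n => eLpNorm (fun s => (φ n).toFun s - f s) 2 volume) atTop (𝓝 0) := by
    have hB' : Tendsto B atTop (𝓝 0) :=
      ENNReal.tendsto_pow_atTop_nhds_zero_of_lt_one (by simp)
    refine tendsto_of_tendsto_of_tendsto_of_le_of_le tendsto_const_nhds hB' (fun _ => zero_le)
      fun n => (hφ n).trans ?_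
    calc (C + 1)⁻¹ * (B n / 4) ≤ 1 * (B n / 1) := by gcongr <;> simp
      _ = B n := by simp
  obtain ⟨Y, hY, hYlim⟩ := Lp.cauchy_complete_eLpNorm (p := 2) (by norm_num)
    (fun n => (φ n).memLp_integral hZ) (B := B) (by simp [hB, ENNReal.tsum_geometric]) (by
      intro N n m hn hm
      have h1 : eLpNorm (fun s => (φ n).toFun s - (φ m).toFun s) 2 volume ≤
          (C + 1)⁻¹ * (B N / 2) := by
        have h2 : (fun s => (φ n).toFun s - (φ m).toFun s) =
            (fun s => (φ n).toFun s - f s) - (fun s => (φ m).toFun s - f s) := by ext s; simp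
        have hm' (n) := ((φ n).memLp_toFun.sub hf).1
        rw [h2]
        calc _ ≤ _ := eLpNorm_sub_le (hm' n) (hm' m) (by norm_num)
          _ ≤ (C + 1)⁻¹ * (B N / 4) + (C + 1)⁻¹ * (B N / 4) := by
            refine add_le_add ((hφ n).trans ?_) ((hφ m).trans ?_) <;> gcongr <;>
              exact hBanti ‹_›
          _ = _ := by
            rw [← mul_add, ← two_mul, ← mul_div_assoc, mul_comm 2 (B N)]
            congr 1
            rw [show (4 : ℝ≥0∞) = 2 * 2 by norm_num,
              ENNReal.mul_div_mul_right _ _ (by simp) (by simp)]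
      calc _ = C * _ := StepData.eLpNorm_integral_sub_integral (φ n) (φ m) hZ hv hv0
        _ ≤ (C + 1) * ((C + 1)⁻¹ * (B N / 2)) := by gcongr; simp
        _ = B N / 2 := by rw [← mul_assoc, ENNReal.mul_inv_cancel (by simp) hC1, one_mul]
        _ < B N := ENNReal.half_lt_self (hB0 N) (hBt N))
  exact ⟨Y, hf, hY, φ, hlim, hYlim⟩

/-- Coordinatewise `L²` convergence gives convergence in measure of the vectors, hence in
distribution, where limits are unique. -/
lemma identDistrib_of_tendsto_eLpNorm [IsProbabilityMeasure P] {ι : Type*} [Fintype ι]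
    {U V : ℕ → Ω → ι → ℝ} {u v : Ω → ι → ℝ}
    (hU : ∀ n i, MemLp (fun ω => U n ω i) 2 P) (hV : ∀ n i, MemLp (fun ω => V n ω i) 2 P)
    (hu : ∀ i, MemLp (fun ω => u ω i) 2 P) (hv : ∀ i, MemLp (fun ω => v ω i) 2 P)
    (hUu : ∀ i, Tendsto (fun n => eLpNorm (fun ω => U n ω i - u ω i) 2 P) atTop (𝓝 0))
    (hVv : ∀ i, Tendsto (fun n => eLpNorm (fun ω => V n ω i - v ω i) 2 P) atTop (𝓝 0))
    (h : ∀ n, IdentDistrib (U n) (V n) P P) : IdentDistrib u v P P := by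
  have key : ∀ {W : ℕ → Ω → ι → ℝ} {w : Ω → ι → ℝ}, (∀ n i, MemLp (fun ω => W n ω i) 2 P) →
      (∀ i, MemLp (fun ω => w ω i) 2 P) →
      (∀ i, Tendsto (fun n => eLpNorm (fun ω => W n ω i - w ω i) 2 P) atTop (𝓝 0)) →
      TendstoInDistribution W atTop w (fun _ => P) P := by
    intro W w hW hw hlim
    have hWm (n) : AEMeasurable (W n) P := aemeasurable_pi_lambda _ fun i => (hW n i).1.aemeasurable
    have hwm : AEMeasurable w P := aemeasurable_pi_lambda _ fun i => (hw i).1.aemeasurable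
    refine TendstoInMeasure.tendstoInDistribution ?_ hWm
    refine tendstoInMeasure_of_tendsto_eLpNorm (p := 2) (by simp)
      (fun n => (hWm n).aestronglyMeasurable) hwm.aestronglyMeasurable ?_
    have hsum := tendsto_finsetSum (Finset.univ : Finset ι) fun i _ => hlim i
    rw [Finset.sum_const_zero] at hsum
    refine tendsto_of_tendsto_of_tendsto_of_le_of_le tendsto_const_nhds hsum (fun _ => zero_le)
      fun n => ?_
    calc eLpNorm (W n - w) 2 P ≤ eLpNorm (∑ i, fun ω => ‖W n ω i - w ω i‖) 2 P := by
          refine eLpNorm_mono_real fun ω => ?_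
          rw [Finset.sum_apply]
          exact (pi_norm_le_iff_of_nonneg (Finset.sum_nonneg fun i _ => norm_nonneg _)).2 fun i =>
            Finset.single_le_sum (f := fun i => ‖W n ω i - w ω i‖)
              (fun i _ => norm_nonneg _) (Finset.mem_univ i)
      _ ≤ ∑ i, eLpNorm (fun ω => ‖W n ω i - w ω i‖) 2 P :=
          eLpNorm_sum_le (fun i _ => ((hW n i).sub (hw i)).norm.1) (by norm_num)
      _ = _ := Finset.sum_congr rfl fun i _ => eLpNorm_norm (fun ω => W n ω i - w ω i)
  have hTU := key hU hu hUu
  have hTV := key hV hv hVv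
  have hTU' : TendstoInDistribution U atTop v (fun _ => P) P := by
    refine ⟨hTU.forall_aemeasurable, hTV.aemeasurable_limit, ?_⟩
    exact hTV.tendsto.congr fun n => Subtype.ext (h n).map_eq.symm
  exact ⟨hTU.aemeasurable_limit, hTV.aemeasurable_limit, tendstoInDistribution_unique U hTU hTU'⟩

/-! ### Laws and variances of increments -/

namespace IsTwoSidedLevyProcess

variable {k : ℕ} {L : ℝ → Ω → EuclideanSpace ℝ (Fin k)}

lemma identDistrib_increments_of_monotone (hL : IsTwoSidedLevyProcess P L) (τ : ℝ) {n : ℕ}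
    {t : Fin (n + 1) → ℝ} (ht : Monotone t) :
    IdentDistrib (fun ω (i : Fin n) => L (t i.succ + τ) ω - L (t i.castSucc + τ) ω)
      (fun ω (i : Fin n) => L (t i.succ) ω - L (t i.castSucc) ω) P P :=
  IdentDistrib.pi (fun i => hL.stationary_increments _ _ (ht i.castSucc_lt_succ.le) τ)
    (hL.indep_increments n (fun i => t i + τ) fun _ _ h => by simpa using ht h)
    (hL.indep_increments n t ht)

/-- The joint law of finitely many increments of a Lévy process is invariant under time shifts. -/
lemma identDistrib_increments (hL : IsTwoSidedLevyProcess P L) (τ : ℝ) {ι : Type*} [Finite ι]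
    (s t : ι → ℝ) :
    IdentDistrib (fun ω i => L (t i + τ) ω - L (s i + τ) ω)
      (fun ω i => L (t i) ω - L (s i) ω) P P := by
  classical
  have := Fintype.ofFinite ι
  -- Inserting `0` only guarantees that the set of endpoints is nonempty.
  set S : Finset ℝ := insert 0 (Finset.univ.image s ∪ Finset.univ.image t) with hS
  obtain ⟨n, hn⟩ : ∃ n, S.card = n + 1 :=
    ⟨_, (Nat.succ_pred_eq_of_pos (Finset.card_pos.2 (Finset.insert_nonempty _ _))).symm⟩
  set e := S.orderEmbOfFin hn with he
  have hr : ∀ x ∈ S, ∃ i, e i = x := fun x hx => by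
    have := Finset.range_orderEmbOfFin S hn
    exact (Set.ext_iff.1 this x).2 hx
  choose p hp using fun i => hr (s i) (by simp [hS])
  choose q hq using fun i => hr (t i) (by simp [hS])
  -- Partial sums of consecutive increments recover the path up to its value at the first grid
  -- point, which cancels in differences.
  let Φ : (Fin n → EuclideanSpace ℝ (Fin k)) → Fin (n + 1) → EuclideanSpace ℝ (Fin k) :=
    fun x i => ∑ l : Fin n, if l.castSucc < i then x l else 0
  have hΦ : ∀ g : Fin (n + 1) → EuclideanSpace ℝ (Fin k), ∀ i,
      Φ (fun l => g l.succ - g l.castSucc) i = g i - g 0 := by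
    intro g i
    induction i using Fin.induction with
    | zero => simp [Φ]
    | succ i ih =>
      have : Φ (fun l => g l.succ - g l.castSucc) i.succ =
          Φ (fun l => g l.succ - g l.castSucc) i.castSucc + (g i.succ - g i.castSucc) := by
        have h1 : g i.succ - g i.castSucc =
            ∑ l : Fin n, if l = i then g l.succ - g l.castSucc else 0 := by simp
        simp only [Φ]
        rw [h1, ← Finset.sum_add_distrib]
        refine Finset.sum_congr rfl fun l _ => ?_
        rcases lt_trichotomy l i with hl | rfl | hl
        · simp [hl, hl.ne, Fin.castSucc_lt_succ_iff, hl.le]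
        · simp
        · simp [hl.not_gt, hl.ne', Fin.castSucc_lt_succ_iff, hl.not_ge]
      rw [this, ih]
      abel
  have hΦm : Measurable Φ := by
    refine measurable_pi_lambda _ fun i => Finset.measurable_sum _ fun l _ => ?_
    split_ifs
    · exact measurable_pi_apply l
    · exact measurable_const
  have hΨ : Measurable fun (x : Fin n → EuclideanSpace ℝ (Fin k)) (i : ι) =>
      Φ x (q i) - Φ x (p i) := by
    refine measurable_pi_lambda _ fun i => ?_
    exact ((measurable_pi_apply (q i)).comp hΦm).sub ((measurable_pi_apply (p i)).comp hΦm)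
  have := (hL.identDistrib_increments_of_monotone τ e.monotone).comp hΨ
  convert this using 1
  · ext1 ω
    ext1 i
    have := hΦ (fun l => L (e l + τ) ω)
    simp only [Function.comp_apply, this, hp, hq]
    abel
  · ext1 ω
    ext1 i
    have := hΦ (fun l => L (e l) ω)
    simp only [Function.comp_apply, this, hp, hq]
    abel

/-- All increments of all the step functions are pooled into one family; the integrals are a fixed
measurable map of it. -/
lemma identDistrib_elementary_integrals (hL : IsTwoSidedLevyProcess P L) (τ : ℝ) {ι : Type*}
    [Fintype ι] (φ : ι → StepData) (c : ι → Fin k) :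
    IdentDistrib (fun ω i => ((φ i).shift τ).integral (fun s ω => L s ω (c i)) ω)
      (fun ω i => (φ i).integral (fun s ω => L s ω (c i)) ω) P P := by
  have h := hL.identDistrib_increments τ (ι := Σ i, Fin (φ i).n)
    (fun x => (φ x.1).a x.2) (fun x => (φ x.1).b x.2)
  have hm : Measurable fun (x : (Σ i, Fin (φ i).n) → EuclideanSpace ℝ (Fin k)) (i : ι) =>
      ∑ l, (φ i).c l * x ⟨i, l⟩ (c i) := by
    refine measurable_pi_lambda _ fun i => Finset.measurable_sum _ fun l _ => ?_
    fun_prop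
  exact h.comp hm

variable [IsProbabilityMeasure P]

/-- The variance over `[0, h]` is additive in `h`, since independent centred increments are
orthogonal; being nonnegative, it is linear without appeal to continuity. -/
lemma integral_increment_sq (hL : IsTwoSidedLevyProcess P L) (hL_sq : ∀ t, MemLp (L t) 2 P)
    (hL_mean : ∀ t, ∫ ω, L t ω ∂P = 0) (j : Fin k) (s t : ℝ) :
    ∫ ω, (L t ω j - L s ω j) ^ 2 ∂P = (∫ ω, (L 1 ω j - L 0 ω j) ^ 2 ∂P) * |t - s| := by
  have hsq (t) : MemLp (fun ω => L t ω j) 2 P :=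
    (EuclideanSpace.proj (𝕜 := ℝ) j).comp_memLp' (hL_sq t)
  have hmean (t) : ∫ ω, L t ω j ∂P = 0 := by
    have := (EuclideanSpace.proj (𝕜 := ℝ) j).integral_comp_comm ((hL_sq t).integrable (by norm_num))
    simpa [hL_mean] using this
  have hinc (s t) : MemLp (fun ω => L t ω j - L s ω j) 2 P := (hsq t).sub (hsq s)
  have hincm (s t) : ∫ ω, L t ω j - L s ω j ∂P = 0 := by
    rw [integral_sub ((hsq t).integrable (by norm_num)) ((hsq s).integrable (by norm_num)),
      hmean, hmean, sub_zero]
  set V : ℝ → ℝ := fun h => ∫ ω, (L h ω j - L 0 ω j) ^ 2 ∂P with hV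
  have hstat : ∀ s t, s ≤ t → ∫ ω, (L t ω j - L s ω j) ^ 2 ∂P = V (t - s) := by
    intro s t hst
    have h1 := hL.stationary_increments 0 (t - s) (by linarith) s
    have h2 : Measurable fun x : EuclideanSpace ℝ (Fin k) => x j ^ 2 := by fun_prop
    simpa using (h1.comp h2).integral_eq
  have hadd : ∀ x y, 0 ≤ x → 0 ≤ y → V (x + y) = V x + V y := by
    intro x y hx hy
    have hind : IndepFun (fun ω => L x ω j - L 0 ω j) (fun ω => L (x + y) ω j - L x ω j) P :=
      (hL.indep_increments.indepFun_sub_sub hx (by linarith : x ≤ x + y)).comp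
        (φ := fun z : EuclideanSpace ℝ (Fin k) => z j)
        (ψ := fun z : EuclideanSpace ℝ (Fin k) => z j) (by fun_prop) (by fun_prop)
    have hcross : ∫ ω, (L x ω j - L 0 ω j) * (L (x + y) ω j - L x ω j) ∂P = 0 := by
      rw [hind.integral_fun_mul_eq_mul_integral (hinc _ _).1 (hinc _ _).1, hincm, zero_mul]
    have hexp : ∀ ω, (L (x + y) ω j - L 0 ω j) ^ 2 = (L x ω j - L 0 ω j) ^ 2 +
        (L (x + y) ω j - L x ω j) ^ 2 +
        2 * ((L x ω j - L 0 ω j) * (L (x + y) ω j - L x ω j)) := fun ω => by ring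
    have h3 := hstat x (x + y) (by linarith)
    rw [add_sub_cancel_left] at h3
    simp_rw [hV, hexp]
    have h4 : Integrable (fun ω => (L x ω j - L 0 ω j) ^ 2 + (L (x + y) ω j - L x ω j) ^ 2) P :=
      (hinc _ _).integrable_sq.add (hinc _ _).integrable_sq
    have h5 : Integrable (fun ω => (L x ω j - L 0 ω j) * (L (x + y) ω j - L x ω j)) P :=
      (hinc _ _).integrable_mul (hinc _ _)
    rw [integral_add h4 (h5.const_mul 2), integral_add (hinc _ _).integrable_sq
      (hinc _ _).integrable_sq, integral_const_mul, hcross, h3]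
    simp [hV]
  have hV0 : ∀ x, 0 ≤ V x := fun _ => integral_nonneg fun _ => sq_nonneg _
  have hlin {x : ℝ} (hx : 0 ≤ x) : V x = V 1 * x :=
    eq_mul_of_additive_nonneg hV0 hadd hx
  rcases le_total s t with hst | hst
  · rw [hstat s t hst, abs_of_nonneg (by linarith), hlin (by linarith)]
  · simp_rw [fun ω => sub_sq_comm (L t ω j) (L s ω j)]
    rw [hstat t s hst, abs_of_nonpos (by linarith), neg_sub, hlin (by linarith)]

end IsTwoSidedLevyProcess

/-! ### Kernels and their translates -/

lemma memLp_kernel {g : ℝ → ℝ} (hg : MemLp g 2 (volume.restrict (Set.Ici (0 : ℝ)))) (t : ℝ) :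
    MemLp ((Set.Iic t).indicator fun s => g (t - s)) 2 volume := by
  have h := (memLp_indicator_iff_restrict measurableSet_Ici).2 hg
  have h' := h.comp_measurePreserving (Measure.measurePreserving_sub_left volume t)
  convert h' using 1
  ext s
  simp [Set.indicator_apply]

/-- If step functions `φ n` converge to `f₀` in `L²`, then the elementary integrals of their
translates by `τ` converge to the stochastic integral of the translate of `f₀`. -/
lemma IsStochIntegral.tendsto_shift {Z : ℝ → Ω → ℝ} {v : ℝ} (hZ : ∀ t, MemLp (Z t) 2 P)
    (hv : ∀ s t, ∫ ω, (Z t ω - Z s ω) ^ 2 ∂P = v * |t - s|) (hv0 : 0 ≤ v) {f : ℝ → ℝ} {Y : Ω → ℝ}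
    (hY : IsStochIntegral P Z f Y) {f₀ : ℝ → ℝ} {τ : ℝ} (hf : ∀ s, f s = f₀ (s - τ))
    (hf₀ : MemLp f₀ 2 volume) {φ : ℕ → StepData}
    (hφ : Tendsto (fun n => eLpNorm (fun s => (φ n).toFun s - f₀ s) 2 volume) atTop (𝓝 0)) :
    Tendsto (fun n => eLpNorm (fun ω => ((φ n).shift τ).integral Z ω - Y ω) 2 P) atTop (𝓝 0) := by
  obtain ⟨hfm, hYm, ψ, hψ, hψY⟩ := hY
  have hshift (n) : eLpNorm (fun s => ((φ n).shift τ).toFun s - f s) 2 volume =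
      eLpNorm (fun s => (φ n).toFun s - f₀ s) 2 volume := by
    simp_rw [StepData.toFun_shift, hf]
    exact eLpNorm_comp_measurePreserving (g := fun s => (φ n).toFun s - f₀ s)
      ((φ n).memLp_toFun.sub hf₀).1 (measurePreserving_sub_right volume τ)
  have hlim : Tendsto (fun n => ENNReal.ofReal (√v) *
      (eLpNorm (fun s => (φ n).toFun s - f₀ s) 2 volume +
        eLpNorm (fun s => (ψ n).toFun s - f s) 2 volume) +
      eLpNorm (fun ω => (ψ n).integral Z ω - Y ω) 2 P) atTop (𝓝 0) := by
    simpa using (ENNReal.Tendsto.const_mul (hφ.add hψ) (Or.inr (by simp))).add hψY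
  refine tendsto_of_tendsto_of_tendsto_of_le_of_le tendsto_const_nhds hlim (fun _ => zero_le)
    fun n => ?_
  -- Compare through `ψ`, the sequence defining `Y`: the isometry controls the difference of the two
  -- elementary integrals.
  have h1 : (fun ω => ((φ n).shift τ).integral Z ω - Y ω) =
      (fun ω => ((φ n).shift τ).integral Z ω - (ψ n).integral Z ω) +
        fun ω => (ψ n).integral Z ω - Y ω := by ext ω; simp
  have h2 : (fun s => ((φ n).shift τ).toFun s - (ψ n).toFun s) =
      (fun s => ((φ n).shift τ).toFun s - f s) - fun s => (ψ n).toFun s - f s := by ext s; simp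
  simp only
  rw [h1, ← hshift]
  refine (eLpNorm_add_le ((((φ n).shift τ).memLp_integral hZ).sub ((ψ n).memLp_integral hZ)).1
    (((ψ n).memLp_integral hZ).sub hYm).1 (by norm_num)).trans ?_
  refine add_le_add ?_ le_rfl
  refine (StepData.eLpNorm_integral_sub_integral _ _ hZ hv hv0).trans_le ?_
  rw [h2]
  gcongr
  exact eLpNorm_sub_le (((φ n).shift τ).memLp_toFun.sub hfm).1 ((ψ n).memLp_toFun.sub hfm).1
    (by norm_num)

end LevyStationary

/-! ### Existence and strict stationarity -/

theorem lemma2p9 {Ω : Type*} [MeasurableSpace Ω] (P : Measure Ω) [IsProbabilityMeasure P]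
    {m k : ℕ} (L : ℝ → Ω → EuclideanSpace ℝ (Fin k))
    (hL : LevyStationary.IsTwoSidedLevyProcess P L)
    (hL_sq : ∀ t, MemLp (L t) 2 P)
    (hL_mean : ∀ t, ∫ ω, L t ω ∂P = 0)
    (G : ℝ → Matrix (Fin m) (Fin k) ℝ)
    (hG : ∀ i j, MemLp (fun u => G u i j) 2 (volume.restrict (Set.Ici (0 : ℝ)))) :
    (∃ X : ℝ → Ω → EuclideanSpace ℝ (Fin m), LevyStationary.IsLevyStationaryProcess P L G X) ∧
    ∀ X : ℝ → Ω → EuclideanSpace ℝ (Fin m), LevyStationary.IsLevyStationaryProcess P L G X →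
      LevyStationary.IsStrictlyStationary P X := by
  have hsq (j : Fin k) (t) : MemLp (fun ω => L t ω j) 2 P :=
    (EuclideanSpace.proj (𝕜 := ℝ) j).comp_memLp' (hL_sq t)
  have hvar := hL.integral_increment_sq hL_sq hL_mean
  have hvar0 (j : Fin k) : 0 ≤ ∫ ω, (L 1 ω j - L 0 ω j) ^ 2 ∂P :=
    integral_nonneg fun _ => sq_nonneg _
  constructor
  · choose Y hY using fun (t : ℝ) (i : Fin m) (j : Fin k) =>
      LevyStationary.exists_isStochIntegral (hsq j) (hvar j) (hvar0 j)
        (LevyStationary.memLp_kernel (hG i j) t)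
    exact ⟨fun t ω => WithLp.toLp 2 fun i => ∑ j, Y t i j ω, Y, hY,
      fun t => Eventually.of_forall fun ω i => rfl⟩
  · rintro X ⟨Y, hY, hX⟩ τ - r t
    -- The same step functions serve both times: unshifted for `t`, shifted by `τ` for `t + τ`.
    choose φ hφ hφY using fun t i j => (hY t i j).2.2
    have hshift (q : Fin r × Fin m × Fin k) : Tendsto (fun n => eLpNorm (fun ω =>
        ((φ (t q.1) q.2.1 q.2.2 n).shift τ).integral (fun s ω => L s ω q.2.2) ω -
          Y (t q.1 + τ) q.2.1 q.2.2 ω) 2 P) atTop (𝓝 0) := by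
      refine (hY (t q.1 + τ) q.2.1 q.2.2).tendsto_shift (hsq q.2.2) (hvar q.2.2) (hvar0 q.2.2)
        (fun s => ?_) (LevyStationary.memLp_kernel (hG q.2.1 q.2.2) (t q.1)) (hφ _ _ _)
      simp only [Set.indicator_apply, Set.mem_Iic, sub_le_iff_le_add]
      congr 2
      ring
    have hYdist : IdentDistrib
        (fun ω (q : Fin r × Fin m × Fin k) => Y (t q.1 + τ) q.2.1 q.2.2 ω)
        (fun ω (q : Fin r × Fin m × Fin k) => Y (t q.1) q.2.1 q.2.2 ω) P P :=
      LevyStationary.identDistrib_of_tendsto_eLpNorm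
        (fun n q => ((φ (t q.1) q.2.1 q.2.2 n).shift τ).memLp_integral (hsq q.2.2))
        (fun n q => (φ (t q.1) q.2.1 q.2.2 n).memLp_integral (hsq q.2.2))
        (fun q => (hY (t q.1 + τ) q.2.1 q.2.2).2.1) (fun q => (hY (t q.1) q.2.1 q.2.2).2.1)
        hshift (fun q => hφY (t q.1) q.2.1 q.2.2)
        (fun n => hL.identDistrib_elementary_integrals τ
          (fun q : Fin r × Fin m × Fin k => φ (t q.1) q.2.1 q.2.2 n) fun q => q.2.2)
    have hm : Measurable fun (y : Fin r × Fin m × Fin k → ℝ) (l : Fin r) =>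
        (WithLp.toLp 2 fun i => ∑ j, y (l, i, j) : EuclideanSpace ℝ (Fin m)) := by
      fun_prop
    have hcongr (t : Fin r → ℝ) : (fun ω l => (WithLp.toLp 2 fun i => ∑ j, Y (t l) i j ω :
        EuclideanSpace ℝ (Fin m))) =ᵐ[P] fun ω l => X (t l) ω := by
      filter_upwards [ae_all_iff.2 fun l => hX (t l)] with ω hω
      ext l i
      exact (hω l i).symm
    have hdist := hYdist.comp hm
    have h1 := hdist.aemeasurable_fst.congr (hcongr fun l => t l + τ)
    have h2 := hdist.aemeasurable_snd.congr (hcongr t)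
    refine ⟨h1, h2, ?_⟩
    rw [← Measure.map_congr (hcongr fun l => t l + τ), ← Measure.map_congr (hcongr t)]
    exact hdist.map_eq
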